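/- Let $d\ge 1$ be an integer. Let $R_d$ be the set of the $d$ reflections in the dihedral group $D_d$ of order $2d$, and put $x\triangleright y = xyx^{-1}$ for $x,y\in R_d$. Let $\mathrm{As}^+(R_d)$ be the structure monoid of the set-theoretic Yang--Baxter solution $(x,y)\mapsto (x\triangleright y,\,x)$ on $R_d$, that is, the monoid presented by generators $e_x$ $(x\in R_d)$ and relations $e_xe_y = e_{x\triangleright y}\,e_x$ $(x,y\in R_d)$. Let $\mathcal{G}_{\mathrm{As}^+(R_d)}(t)=\sum_{n\ge 0} a_n t^n$ be its growth series with respect to $S=\{e_x : x\in R_d\}$: here $a_n$ is the number of elements of $\mathrm{As}^+(R_d)$ that are products of $n$ elements of $S$ and not of fewer than $n$. Then, as formal power series, \[\mathcal{G}_{\mathrm{As}^+(R_d)}(t)=1+d\cdot\left(t+\left(\sum_{c\mid d}\frac{\varphi(c)}{c}\right)t^2+\tau(d)\,\frac{t^3}{1-t}+\tau\!\left(\frac d2\right)\frac{t^4}{2(1-t)^2}\right),\] where the sum runs over the positive divisors $c$ of $d$, $\varphi$ is Euler's totient function, and $\tau(a)$ is the number of positive divisors of $a$ if $a$ is a positive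 integer, and $\tau(a)=0$ if $a$ is not a positive integer. -/

import Mathlib

open scoped Pointwise

namespace YangBaxterGrowth

/-- The defining relations `e_x e_y = e_{λ_x(y)} e_{ρ_y(x)}` of the structure monoid of a map
`r (x, y) = (λ_x(y), ρ_y(x))`. -/
inductive StructureRel {X : Type*} (r : X × X → X × X) : FreeMonoid X → FreeMonoid X → Prop
  | braid (x y : X) :
      StructureRel r (FreeMonoid.of x * FreeMonoid.of y)
        (FreeMonoid.of (r (x, y)).1 * FreeMonoid.of (r (x, y)).2)

/-- The structure monoid `As⁺(X, r)`: generators `e_x` for `x : X`, subject to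
`e_x e_y = e_{λ_x(y)} e_{ρ_y(x)}`. -/
abbrev StructureMonoid {X : Type*} (r : X × X → X × X) : Type _ :=
  PresentedMonoid (StructureRel r)

/-- The standard generating set `{e_x : x ∈ X}` of the structure monoid. -/
def standardGenerators {X : Type*} (r : X × X → X × X) : Set (StructureMonoid r) :=
  Set.range (PresentedMonoid.of (StructureRel r))

/-- The growth series of a monoid `M` with respect to a subset `S`: its `n`-th coefficient is the
number of elements of `M` that are products of `n` elements of `S`, and not of fewer. -/
noncomputable def growthSeries {M : Type*} [Monoid M] (S : Set M) : PowerSeries ℚ :=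
  PowerSeries.mk fun n => (((S ^ n \ ⋃ i < n, S ^ i : Set M).ncard : ℕ) : ℚ)

/-- The conjugation solution `r(x, y) = (x ▷ y, x)`, `x ▷ y = x y x⁻¹`, on a subset `C` of a group
that is stable under conjugation by its own elements. -/
def conjSolution {G : Type*} [Group G] (C : Set G)
    (hC : ∀ x ∈ C, ∀ y ∈ C, x * y * x⁻¹ ∈ C) : C × C → C × C :=
  fun p => (⟨p.1.1 * p.2.1 * p.1.1⁻¹, hC p.1.1 p.1.2 p.2.1 p.2.2⟩, p.1)

/-- The set `R_d` of reflections in the dihedral group `D_d` of order `2 d`. -/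
def reflections (d : ℕ) : Set (DihedralGroup d) :=
  Set.range DihedralGroup.sr

theorem sr_conj_sr (d : ℕ) (i j : ZMod d) :
    DihedralGroup.sr i * DihedralGroup.sr j * (DihedralGroup.sr i)⁻¹
      = DihedralGroup.sr (2 * i - j) := by
  simp only [DihedralGroup.sr_mul_sr, DihedralGroup.inv_sr, DihedralGroup.r_mul_sr]
  congr 1
  ring

theorem reflections_conj_mem (d : ℕ) :
    ∀ x ∈ reflections d, ∀ y ∈ reflections d, x * y * x⁻¹ ∈ reflections d := by
  rintro _ ⟨i, rfl⟩ _ ⟨j, rfl⟩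
  exact ⟨2 * i - j, (sr_conj_sr d i j).symm⟩

/-- The reflection solution `(R_d, r_▷)`. -/
def reflectionSolution (d : ℕ) : reflections d × reflections d → reflections d × reflections d :=
  conjSolution (reflections d) (reflections_conj_mem d)

/-- The number-of-divisors function, extended by `0` to the rational numbers that are not
positive integers. -/
def numDivisors (a : ℚ) : ℕ :=
  if 0 < a ∧ a.den = 1 then (Nat.divisors a.num.toNat).card else 0

end YangBaxterGrowth

namespace YangBaxterGrowth

/-! Letters are integers modulo `d`, and the relations read `e_i e_j = e_{2i-j} e_i`. They preserve
the length of a word, its alternating sum mod `d` (its image in the dihedral group), the gap `g`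
(largest divisor of `d` modulo which all letters agree), the common class mod `g`, and the multiset
of letters mod `gcd (2g) d`, because `2i - j ≡ j` mod `2g` when `i ≡ j` mod `g`.

From length three on these invariants are complete (`word_eq_of_invariants`). In length three the
relations act as transvections, so Euclid's algorithm gives a normal form (`word_triple`). Longer
words can be rewritten to begin `x x (x-g)`; two words with equal invariants can be given the same
`x`, and deleting it keeps the gap, so induction applies.

Counting for a divisor `g`: there are `g` classes. If `2g ∤ d`, the multiset is forced and `d/g`
alternating sums remain, giving `d` elements. If `2g ∣ d`, both classes mod `2g` occur, so length
`m+3` allows `m+2` multisets, each with `d/(2g)` alternating sums, giving `d + dm/2`. In length two,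
only the difference `δ` and the first letter mod `gcd d δ` survive, giving `∑ gcd d δ`. -/

/-! ### Generators and words -/

theorem sr_mem_reflections {d : ℕ} (i : ZMod d) : DihedralGroup.sr i ∈ reflections d :=
  Set.mem_range_self i

/-- The generator of the structure monoid of the reflection solution given by an integer. -/
def gen (d : ℕ) (i : ℤ) : StructureMonoid (reflectionSolution d) :=
  PresentedMonoid.of _ ⟨DihedralGroup.sr (i : ZMod d), sr_mem_reflections _⟩

theorem gen_congr {d : ℕ} {i j : ℤ} (h : (d : ℤ) ∣ i - j) : gen d i = gen d j := by
  have : (i : ZMod d) = j := by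
    rw [← sub_eq_zero, ← Int.cast_sub]
    exact (ZMod.intCast_zmod_eq_zero_iff_dvd _ _).2 h
  unfold gen
  simp only [this]

theorem gen_mul_gen (d : ℕ) (i j : ℤ) : gen d i * gen d j = gen d (2 * i - j) * gen d i := by
  have h := PresentedMonoid.mk_eq_mk_of_rel (StructureRel.braid (r := reflectionSolution d)
    ⟨DihedralGroup.sr (i : ZMod d), _, rfl⟩ ⟨DihedralGroup.sr (j : ZMod d), _, rfl⟩)
  rw [map_mul, map_mul] at h
  have e : (reflectionSolution d (⟨DihedralGroup.sr (i : ZMod d), _, rfl⟩,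
      ⟨DihedralGroup.sr (j : ZMod d), _, rfl⟩)).1
      = ⟨DihedralGroup.sr ((2 * i - j : ℤ) : ZMod d), _, rfl⟩ := by
    apply Subtype.ext
    simp only [reflectionSolution, conjSolution, sr_conj_sr]
    push_cast
    rfl
  rw [e] at h
  exact h

theorem exists_gen_eq {d : ℕ} (x : reflections d) :
    ∃ i : ℤ, PresentedMonoid.of (StructureRel (reflectionSolution d)) x = gen d i := by
  obtain ⟨_, i, rfl⟩ := x
  obtain ⟨i, rfl⟩ := ZMod.intCast_surjective i
  exact ⟨i, rfl⟩

theorem standardGenerators_eq (d : ℕ) :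
    standardGenerators (reflectionSolution d) = Set.range (gen d) := by
  ext m
  constructor
  · rintro ⟨x, rfl⟩
    obtain ⟨i, hi⟩ := exists_gen_eq x
    exact ⟨i, hi.symm⟩
  · rintro ⟨i, rfl⟩
    exact ⟨_, rfl⟩

/-- The element of the structure monoid spelled by a list of integers. -/
def word (d : ℕ) (u : List ℤ) : StructureMonoid (reflectionSolution d) := (u.map (gen d)).prod

@[simp] theorem word_nil (d : ℕ) : word d [] = 1 := rfl

@[simp] theorem word_cons (d : ℕ) (x : ℤ) (u : List ℤ) :
    word d (x :: u) = gen d x * word d u := by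
  simp [word]

theorem word_append (d : ℕ) (u v : List ℤ) : word d (u ++ v) = word d u * word d v := by
  simp [word]

theorem standardGenerators_pow (d n : ℕ) :
    standardGenerators (reflectionSolution d) ^ n = {m | ∃ u, u.length = n ∧ word d u = m} := by
  rw [standardGenerators_eq]
  induction n with
  | zero =>
    ext m
    simp only [pow_zero, Set.mem_one, List.length_eq_zero_iff, Set.mem_ofPred_eq, exists_eq_left,
      word_nil, eq_comm]
  | succ n ih =>
    rw [pow_succ', ih]
    ext m
    constructor
    · rintro ⟨_, ⟨i, rfl⟩, _, ⟨u, hu, rfl⟩, rfl⟩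
      exact ⟨i :: u, by simp [hu], by simp⟩
    · rintro ⟨u, hu, rfl⟩
      obtain ⟨i, u, rfl⟩ := List.exists_cons_of_length_eq_add_one hu
      exact ⟨_, ⟨i, rfl⟩, _, ⟨u, by simpa using hu, rfl⟩, by simp⟩

/-! ### Invariants: dihedral image and letter multisets -/

/-- The alternating sum of a list of integers. -/
def altSum : List ℤ → ℤ
  | [] => 0
  | x :: u => x - altSum u

@[simp] theorem altSum_nil : altSum [] = 0 := rfl

@[simp] theorem altSum_cons (x : ℤ) (u : List ℤ) : altSum (x :: u) = x - altSum u := rfl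

/-- The canonical morphism from the structure monoid to the dihedral group. -/
def toDihedral (d : ℕ) : StructureMonoid (reflectionSolution d) →* DihedralGroup d :=
  PresentedMonoid.lift (rels := StructureRel (reflectionSolution d)) (fun x : reflections d => (x : DihedralGroup d)) (by
    rintro _ _ ⟨x, y⟩
    simp [reflectionSolution, conjSolution])

theorem toDihedral_gen (d : ℕ) (i : ℤ) : toDihedral d (gen d i) = DihedralGroup.sr (i : ZMod d) :=
  rfl

theorem toDihedral_word (d : ℕ) (u : List ℤ) :
    toDihedral d (word d u) = if Even u.length then DihedralGroup.r (-(altSum u : ZMod d))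
      else DihedralGroup.sr (altSum u : ZMod d) := by
  induction u with
  | nil => simp
  | cons x u ih =>
    rw [word_cons, map_mul, ih, toDihedral_gen]
    by_cases h : Even u.length
    · simp [h, Nat.even_add_one, sub_eq_add_neg]
    · simp [h, Nat.even_add_one]

/-- The residue class of a reflection. -/
noncomputable def index {d : ℕ} (x : reflections d) : ZMod d := x.2.choose

theorem sr_index {d : ℕ} (x : reflections d) : DihedralGroup.sr (index x) = (x : DihedralGroup d) :=
  x.2.choose_spec

theorem index_sr {d : ℕ} (i : ZMod d) (h : DihedralGroup.sr i ∈ reflections d) :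
    index ⟨DihedralGroup.sr i, h⟩ = i := by
  simpa using sr_index ⟨DihedralGroup.sr i, h⟩

theorem index_reflectionSolution {d : ℕ} (x y : reflections d) :
    index (reflectionSolution d (x, y)).1 = 2 * index x - index y := by
  have h : DihedralGroup.sr (index (reflectionSolution d (x, y)).1) = x.1 * y.1 * x.1⁻¹ :=
    sr_index (reflectionSolution d (x, y)).1
  rw [← sr_index x, ← sr_index y, sr_conj_sr] at h
  simpa using h

/-- If all letters of a word are congruent to `c` modulo `k`, the multiset of its letters modulo
a divisor `q` of `2 k`, and zero otherwise. -/
noncomputable def classHom {d k q : ℕ} (hk : k ∣ d) (hq : q ∣ d) (hkq : q ∣ 2 * k) (c : ZMod k) :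
    StructureMonoid (reflectionSolution d) →* WithZero (Multiplicative (Multiset (ZMod q))) :=
  PresentedMonoid.lift (rels := StructureRel (reflectionSolution d)) (fun x => if ZMod.castHom hk (ZMod k) (index x) = c then
      ((Multiplicative.ofAdd {ZMod.castHom hq (ZMod q) (index x)} :
        Multiplicative (Multiset (ZMod q))) : WithZero _) else 0) (by
    rintro _ _ ⟨x, y⟩
    simp only [map_mul, FreeMonoid.lift_eval_of, index_reflectionSolution]
    have hx : (reflectionSolution d (x, y)).2 = x := rfl
    rw [hx]
    generalize index x = i
    generalize index y = j
    obtain ⟨i, rfl⟩ := ZMod.intCast_surjective i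
    obtain ⟨j, rfl⟩ := ZMod.intCast_surjective j
    simp only [map_sub, map_mul, map_ofNat, map_intCast]
    by_cases hi : (i : ZMod k) = c
    · subst hi
      -- Reflecting in a letter of class `c` preserves the class `c`, so both sides of the relation
      -- vanish together.
      have h2 : (2 * (i : ZMod k) - j = i) ↔ (j : ZMod k) = i := by
        constructor
        · intro h; linear_combination -h
        · intro h; linear_combination -h
      by_cases hj : (j : ZMod k) = i
      · rw [if_pos rfl, if_pos hj, if_pos (h2.2 hj)]
        have : (2 * (i : ZMod q) - j) = j := by
          have h3 : (k : ℤ) ∣ i - j := (ZMod.intCast_eq_intCast_iff_dvd_sub _ _ _).1 hj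
          have h4 : (q : ℤ) ∣ 2 * (i - j) :=
            (by exact_mod_cast hkq : (q : ℤ) ∣ 2 * k).trans (mul_dvd_mul_left _ h3)
          have h5 := (ZMod.intCast_zmod_eq_zero_iff_dvd _ _).2 h4
          push_cast at h5
          linear_combination h5
        rw [this, mul_comm]
      · simp [h2, hj]
    · simp [hi])

theorem classHom_word {d k q : ℕ} (hk : k ∣ d) (hq : q ∣ d) (hkq : q ∣ 2 * k) (c : ℤ)
    (u : List ℤ) :
    classHom hk hq hkq c (word d u) = if ∀ x ∈ u, (k : ℤ) ∣ x - c then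
      ((Multiplicative.ofAdd (Multiset.map (Int.cast : ℤ → ZMod q) u) :
        Multiplicative (Multiset (ZMod q))) : WithZero _) else 0 := by
  induction u with
  | nil => rfl
  | cons x u ih =>
    have hx : classHom hk hq hkq c (gen d x) = if (k : ℤ) ∣ x - c then
      ((Multiplicative.ofAdd {(x : ZMod q)} :
        Multiplicative (Multiset (ZMod q))) : WithZero _) else 0 := by
      unfold classHom gen
      rw [PresentedMonoid.lift_of]
      simp only [index_sr, map_intCast, ZMod.intCast_eq_intCast_iff_dvd_sub]
      simp only [dvd_sub_comm]
    rw [word_cons, map_mul, ih, hx]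
    by_cases h1 : (k : ℤ) ∣ x - c
    · by_cases h2 : ∀ y ∈ u, (k : ℤ) ∣ y - c
      · have : ∀ y ∈ x :: u, (k : ℤ) ∣ y - c := by
          simpa [h1] using h2
        rw [if_pos h1, if_pos h2, if_pos this, ← WithZero.coe_mul, ← ofAdd_add,
          Multiset.singleton_add, ← Multiset.cons_coe, Multiset.map_cons]
      · have : ¬ ∀ y ∈ x :: u, (k : ℤ) ∣ y - c := by
          simpa [h1] using h2
        rw [if_neg h2, if_neg this, mul_zero]
    · have : ¬ ∀ y ∈ x :: u, (k : ℤ) ∣ y - c := by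
        simp [h1]
      rw [if_neg h1, if_neg this, zero_mul]

/-- With `q = 1`, only the vanishing of `classHom` carries information here. -/
theorem forall_dvd_of_word_eq {d k : ℕ} (hk : k ∣ d) {u v : List ℤ} (h : word d u = word d v)
    {c : ℤ} (hu : ∀ x ∈ u, (k : ℤ) ∣ x - c) : ∀ x ∈ v, (k : ℤ) ∣ x - c := by
  have h' := congrArg (classHom hk (one_dvd d) (one_dvd _) c) h
  by_contra hv
  rw [classHom_word, classHom_word, if_pos hu, if_neg hv] at h'
  exact WithZero.coe_ne_zero h'

theorem multiset_eq_of_word_eq {d k q : ℕ} (hk : k ∣ d) (hq : q ∣ d) (hkq : q ∣ 2 * k)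
    {u v : List ℤ} (h : word d u = word d v) {c : ℤ} (hu : ∀ x ∈ u, (k : ℤ) ∣ x - c) :
    Multiset.map (Int.cast : ℤ → ZMod q) u = Multiset.map (Int.cast : ℤ → ZMod q) v := by
  have hv := forall_dvd_of_word_eq hk h hu
  have h' := congrArg (classHom hk hq hkq c) h
  rw [classHom_word, classHom_word, if_pos hu, if_pos hv] at h'
  exact Multiplicative.ofAdd.injective (WithZero.coe_injective h')

theorem length_eq_of_word_eq {d : ℕ} {u v : List ℤ} (h : word d u = word d v) :
    u.length = v.length := by
  have := multiset_eq_of_word_eq (k := 1) (one_dvd d) (one_dvd d) (one_dvd _) h (c := 0) (by simp)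
  simpa using congrArg Multiset.card this

theorem altSum_eq_of_word_eq {d : ℕ} {u v : List ℤ} (h : word d u = word d v) :
    (d : ℤ) ∣ altSum u - altSum v := by
  have hl := length_eq_of_word_eq h
  have h' := congrArg (toDihedral d) h
  rw [toDihedral_word, toDihedral_word, hl] at h'
  rw [← ZMod.intCast_zmod_eq_zero_iff_dvd, Int.cast_sub, sub_eq_zero]
  split_ifs at h' <;> simpa using h'

/-! ### The gap of a word -/

/-- `g` is the greatest divisor of `d` modulo which all letters of `u` are congruent. -/
def IsGap (d g : ℕ) (u : List ℤ) : Prop :=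
  ∀ k : ℕ, k ∣ g ↔ k ∣ d ∧ ∃ c : ℤ, ∀ x ∈ u, (k : ℤ) ∣ x - c

theorem IsGap.dvd {d g : ℕ} {u : List ℤ} (h : IsGap d g u) : g ∣ d := ((h g).1 dvd_rfl).1

theorem IsGap.dvd_sub {d g : ℕ} {u : List ℤ} (h : IsGap d g u) {x y : ℤ} (hx : x ∈ u)
    (hy : y ∈ u) : (g : ℤ) ∣ x - y := by
  obtain ⟨c, hc⟩ := ((h g).1 dvd_rfl).2
  simpa using (hc x hx).sub (hc y hy)

theorem IsGap.of_word_eq {d g : ℕ} {u v : List ℤ} (hu : IsGap d g u) (h : word d u = word d v) :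
    IsGap d g v := by
  intro k
  rw [hu k]
  constructor
  · rintro ⟨hk, c, hc⟩
    exact ⟨hk, c, forall_dvd_of_word_eq hk h hc⟩
  · rintro ⟨hk, c, hc⟩
    exact ⟨hk, c, forall_dvd_of_word_eq hk h.symm hc⟩

theorem isGap_iff_of_mem {d g : ℕ} {u : List ℤ} {x : ℤ} (hx : x ∈ u) :
    IsGap d g u ↔ ∀ k : ℕ, k ∣ g ↔ k ∣ d ∧ ∀ y ∈ u, (k : ℤ) ∣ y - x := by
  refine forall_congr' fun k => ?_
  have : (∃ c : ℤ, ∀ x ∈ u, (k : ℤ) ∣ x - c) ↔ ∀ y ∈ u, (k : ℤ) ∣ y - x := by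
    constructor
    · rintro ⟨c, hc⟩ y hy
      simpa using (hc y hy).sub (hc x hx)
    · intro h
      exact ⟨x, h⟩
  rw [this]

theorem exists_isGap (d : ℕ) {u : List ℤ} (hu : u ≠ []) : ∃ g, IsGap d g u := by
  obtain ⟨x, v, rfl⟩ := List.exists_cons_of_ne_nil hu
  have : ∀ w : List ℤ, ∃ g : ℕ, ∀ k : ℕ, k ∣ g ↔ k ∣ d ∧ ∀ y ∈ w, (k : ℤ) ∣ y - x := by
    intro w
    induction w with
    | nil => exact ⟨d, by simp⟩
    | cons y w ih =>
      obtain ⟨g, hg⟩ := ih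
      refine ⟨g.gcd (y - x).natAbs, fun k => ?_⟩
      rw [Nat.dvd_gcd_iff, hg, ← Int.natCast_dvd]
      simp only [List.forall_mem_cons]
      tauto
  obtain ⟨g, hg⟩ := this (x :: v)
  exact ⟨g, (isGap_iff_of_mem List.mem_cons_self).2 hg⟩

theorem isGap_of_mem_of_mem {d g : ℕ} {u : List ℤ} (hg : g ∣ d) {x y : ℤ} (hx : x ∈ u)
    (hy : y ∈ u) (hxy : y - x = g) (h : ∀ z ∈ u, (g : ℤ) ∣ z - x) : IsGap d g u := by
  rw [isGap_iff_of_mem hx]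
  intro k
  constructor
  · intro hk
    exact ⟨hk.trans hg, fun z hz => (Int.natCast_dvd_natCast.2 hk).trans (h z hz)⟩
  · rintro ⟨_, hk⟩
    have := hk y hy
    rw [hxy] at this
    exact Int.natCast_dvd_natCast.1 this

/-! ### Transvections and the normal form in length three -/

theorem gen_mul_gen_shift (d : ℕ) (a b k : ℤ) :
    gen d (a + k * (b - a)) * gen d (b + k * (b - a)) = gen d a * gen d b := by
  induction k with
  | zero => simp
  | succ k ih =>
    rw [← ih, gen_mul_gen d (a + ((k : ℤ) + 1) * (b - a))]
    congr 2 <;> ring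
  | pred k ih =>
    rw [← ih, gen_mul_gen d (a + -(k : ℤ) * (b - a))]
    congr 2 <;> ring

/-- Squares of generators are central: reflecting twice in `x` is the identity. -/
theorem gen_sq_mul_gen (d : ℕ) (x y : ℤ) :
    gen d x * (gen d x * gen d y) = gen d y * (gen d x * gen d x) := by
  rw [gen_mul_gen d x y, ← mul_assoc, gen_mul_gen d x, mul_assoc]
  congr 2
  ring

theorem gen_sq_reflect (d : ℕ) (x y : ℤ) :
    gen d (2 * y - x) * (gen d (2 * y - x) * gen d y) = gen d x * (gen d x * gen d y) := by
  rw [gen_sq_mul_gen d x y, ← mul_assoc (gen d y), gen_mul_gen d y x, mul_assoc, gen_mul_gen d y x]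

/-- A function of two integers that is invariant under transvections only depends on the greatest
common divisor. -/
theorem eq_gcd_of_transvection {α : Type*} (f : ℤ → ℤ → α)
    (h₁ : ∀ x y k, f x (y + k * x) = f x y) (h₂ : ∀ x y k, f (x + k * y) y = f x y) (x y : ℤ) :
    f x y = f (Int.gcd x y) 0 := by
  have hneg : ∀ x, f x 0 = f (-x) 0 := fun x => by
    -- The path is `(x, 0) → (x, x) → (-x, x) → (-x, 0)`.
    rw [← h₁ x 0 1, ← h₂ x _ (-2), ← h₁ (-x) 0 (-1)]
    congr 1 <;> ring
  have hswap : ∀ x y, f x y = f y (-x) := fun x y => by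
    rw [← h₂ x y 1, ← h₁ (x + 1 * y) y (-1), ← h₂ _ (y + -1 * (x + 1 * y)) 1]
    congr 1 <;> ring
  induction hn : x.natAbs using Nat.strong_induction_on generalizing x y with
  | _ n ih =>
    by_cases hx : x = 0
    · subst hx
      rw [hswap, neg_zero, Int.gcd_zero_left]
      rcases Int.natAbs_eq y with h | h
      · rw [← h]
      · rw [hneg, ← neg_eq_iff_eq_neg.2 h]
    · have e : f x y = f (y % x) (-x) := by
        rw [hswap, ← h₂ y (-x) (y / x)]
        congr 1
        rw [Int.emod_def]
        ring
      have hlt : (y % x).natAbs < n := by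
        have h1 := Int.emod_nonneg y hx
        have h2 := Int.emod_lt_abs y hx
        rw [Int.abs_eq_natAbs] at h2
        omega
      rw [e, ih _ hlt _ _ rfl, Int.gcd_neg, Int.gcd_emod, Int.gcd_comm]

/-- Normal form of the words of length three. -/
theorem word_triple {d g : ℕ} {a b c : ℤ} (h : IsGap d g [a, b, c]) :
    gen d a * (gen d b * gen d c) =
      gen d (a - b + c + g) * (gen d (a - b + c + g) * gen d (a - b + c)) := by
  set p := a - b + c with hp
  -- Triples with alternating sum `p`, parametrised by the two consecutive differences up to sign;
  -- the relation on either pair of adjacent letters becomes a transvection.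
  let f : ℤ → ℤ → StructureMonoid (reflectionSolution d) := fun x y =>
    gen d (p - y) * (gen d (p + x - y) * gen d (p + x))
  have h₁ : ∀ x y k, f x (y + k * x) = f x y := fun x y k => by
    simp only [f, ← mul_assoc]
    rw [← gen_mul_gen_shift d (p - y) (p + x - y) (-k)]
    congr 3 <;> ring
  have h₂ : ∀ x y k, f (x + k * y) y = f x y := fun x y k => by
    simp only [f]
    rw [← gen_mul_gen_shift d (p + x - y) (p + x) k]
    congr 3 <;> ring
  have h₃ : ∀ x, f x d = f x 0 := fun x => by
    simp only [f]
    congr 1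
    · exact gen_congr ⟨-1, by ring⟩
    · congr 1
      exact gen_congr ⟨-1, by ring⟩
  have hg : g = Int.gcd (Int.gcd (c - p) (p - a)) d := by
    refine Nat.dvd_antisymm ?_ ?_
    · refine Nat.dvd_gcd (Int.dvd_gcd ?_ ?_) ?_
      · have := h.dvd_sub (x := b) (y := a) (by simp) (by simp)
        convert this using 1
        rw [hp]; ring
      · have := h.dvd_sub (x := c) (y := b) (by simp) (by simp)
        convert this using 1
        rw [hp]; ring
      · exact h.dvd
    · rw [isGap_iff_of_mem (x := b) (by simp)] at h
      rw [h]
      have h0 : ((Int.gcd (Int.gcd (c - p) (p - a)) d : ℕ) : ℤ) ∣ (Int.gcd (c - p) (p - a) : ℤ) :=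
        Int.gcd_dvd_left _ _
      refine ⟨Int.natCast_dvd_natCast.1 (Int.gcd_dvd_right _ _), ?_⟩
      simp only [List.forall_mem_cons, List.not_mem_nil, IsEmpty.forall_iff, implies_true, and_true,
        sub_self, dvd_zero, true_and]
      constructor
      · rw [dvd_sub_comm, show b - a = c - p by rw [hp]; ring]
        exact h0.trans (Int.gcd_dvd_left _ _)
      · rw [show c - b = p - a by rw [hp]; ring]
        exact h0.trans (Int.gcd_dvd_right _ _)
  have key := eq_gcd_of_transvection f h₁ h₂ (c - p) (p - a)
  -- Periodicity replaces the zero by `d`, so a second gcd brings `d` in and yields the gap.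
  rw [← h₃, eq_gcd_of_transvection f h₁ h₂ _ d, ← hg] at key
  rw [gen_sq_mul_gen]
  simp only [f] at key
  convert key using 3
  · ring
  · congr 1
    rw [hp]; ring
  · ring_nf
  · ring_nf
  · ring_nf

/-! ### Rewriting words that begin with a square -/

theorem word_congr_cons {d : ℕ} {u v : List ℤ} (x : ℤ) (h : word d u = word d v) :
    word d (x :: u) = word d (x :: v) := by
  rw [word_cons, word_cons, h]

/-- A word of length at least three can be made to start with the square of a generator and a
neighbour of that generator. -/
theorem exists_word_eq_sq {d g : ℕ} {u : List ℤ} (hu : 3 ≤ u.length) (h : IsGap d g u) :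
    ∃ x r, word d u = word d (x :: x :: (x - g) :: r) := by
  induction u generalizing g with
  | nil => simp at hu
  | cons b u ih =>
    rcases hu.lt_or_eq with hlt | heq
    · have hu' : 3 ≤ u.length := by simpa [Nat.lt_succ_iff] using hlt
      obtain ⟨e, he⟩ := exists_isGap d (u := u) (by rintro rfl; simp at hu')
      obtain ⟨x, r, hr⟩ := ih hu' he
      have he' := he.of_word_eq hr
      have hbu := word_congr_cons b hr
      have h' := h.of_word_eq hbu
      -- The letters `x` and `x - e` already account for the gap `e` of the tail, so adding `b`
      -- gives the full gap.
      have hgap : IsGap d g [x, b, x - e] := by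
        rw [isGap_iff_of_mem (x := x) (by simp)] at h' he' ⊢
        intro k
        rw [h' k]
        have hk := he' k
        simp only [List.forall_mem_cons, List.not_mem_nil, IsEmpty.forall_iff, implies_true,
          and_true, sub_self, dvd_zero, true_and, sub_sub_cancel_left, dvd_neg,
          Int.natCast_dvd_natCast] at hk ⊢
        tauto
      refine ⟨x - b + (x - e) + g, (2 * (x - b + (x - e)) - x) :: r, ?_⟩
      rw [hbu]
      simp only [word_cons]
      have h1 := word_triple hgap
      generalize x - b + (x - e) = p at h1 ⊢
      calc gen d b * (gen d x * (gen d x * (gen d (x - e) * word d r)))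
          = gen d b * (gen d x * gen d x) * (gen d (x - e) * word d r) := by
            simp only [mul_assoc]
        _ = gen d x * (gen d x * (gen d b * gen d (x - e))) * word d r := by
            rw [← gen_sq_mul_gen]; simp only [mul_assoc]
        _ = gen d x * (gen d (p + g) * gen d (p + g)) * (gen d p * word d r) := by
            rw [h1]; simp only [mul_assoc]
        _ = gen d (p + g) * (gen d (p + g) * (gen d x * gen d p)) * word d r := by
            rw [← gen_sq_mul_gen]; simp only [mul_assoc]
        _ = _ := by
            have h2 := gen_mul_gen d p (2 * p - x)
            rw [sub_sub_cancel] at h2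
            rw [← h2, add_sub_cancel_right]; simp only [mul_assoc]
    · obtain ⟨a, c, rfl⟩ := List.length_eq_two.1 (by simpa using heq.symm : u.length = 2)
      refine ⟨b - a + c + g, [], ?_⟩
      simp only [word_cons, word_nil, mul_one, add_sub_cancel_right]
      exact word_triple h

/-- The triples `x, x-g, z` and `x, x+g, z+2g` share gap and alternating sum, hence are equal; then
`x x` is reflected in `x+g`. -/
theorem gen_sq_mul_translate_aux {d g : ℕ} (hg : g ∣ d) {x z : ℤ} (hz : (g : ℤ) ∣ z - x) :
    gen d x * (gen d x * (gen d (x - g) * gen d z)) =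
      gen d (x + 2 * g) * (gen d (x + 2 * g) * (gen d (x + 2 * g - g) * gen d (z + 2 * g))) := by
  obtain ⟨l, hl⟩ := hz
  obtain rfl : z = x + g * l := by linarith
  have h1 : IsGap d g [x, x - g, x + g * l] := by
    refine isGap_of_mem_of_mem hg (x := x - g) (y := x) (by simp) (by simp) (by ring) ?_
    simp only [List.forall_mem_cons, List.not_mem_nil, IsEmpty.forall_iff, implies_true, and_true]
    exact ⟨⟨1, by ring⟩, ⟨0, by ring⟩, ⟨l + 1, by ring⟩⟩
  have h2 : IsGap d g [x, x + g, x + g * l + 2 * g] := by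
    refine isGap_of_mem_of_mem hg (x := x) (y := x + g) (by simp) (by simp) (by ring) ?_
    simp only [List.forall_mem_cons, List.not_mem_nil, IsEmpty.forall_iff, implies_true, and_true]
    exact ⟨⟨0, by ring⟩, ⟨1, by ring⟩, ⟨l + 2, by ring⟩⟩
  have e : x - (x + g) + (x + g * l + 2 * g) = x - (x - g) + (x + g * l) := by ring
  have h3 := word_triple h2
  rw [e, ← word_triple h1] at h3
  rw [← h3]
  have h4 := gen_sq_reflect d x (x + g)
  have e2 : 2 * (x + g) - x = x + 2 * g := by ring
  have e3 : x + 2 * g - g = x + g := by ring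
  rw [e2] at h4
  rw [e3]
  simp only [← mul_assoc] at h4 ⊢
  rw [h4]

theorem gen_sq_mul_translate {d g : ℕ} (hg : g ∣ d) {x z : ℤ} (hz : (g : ℤ) ∣ z - x) (k : ℤ) :
    gen d (x + k * (2 * g)) * (gen d (x + k * (2 * g)) *
        (gen d (x + k * (2 * g) - g) * gen d (z + k * (2 * g)))) =
      gen d x * (gen d x * (gen d (x - g) * gen d z)) := by
  induction k with
  | zero => simp
  | succ k ih =>
    rw [← ih, gen_sq_mul_translate_aux hg (x := x + k * (2 * g)) (z := z + k * (2 * g))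
      (by simpa using hz)]
    ring_nf
  | pred k ih =>
    rw [← ih, gen_sq_mul_translate_aux hg (x := x + (-(k : ℤ) - 1) * (2 * g))
      (z := z + (-(k : ℤ) - 1) * (2 * g)) (by simpa using hz)]
    ring_nf

/-- Applies the length-three normal form to the last three letters, then to the first three. It lets
the class of the fourth letter become that of the leading square. -/
theorem gen_sq_mul_swap {d g : ℕ} (hg : g ∣ d) {x z : ℤ} (hz : (g : ℤ) ∣ z - x) :
    gen d x * (gen d x * (gen d (x - g) * gen d z)) =
      gen d (2 * x - z) * (gen d (2 * x - z) * (gen d (2 * x - z - g) * gen d x)) := by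
  obtain ⟨l, hl⟩ := hz
  obtain rfl : z = x + g * l := by linarith
  have h1 : IsGap d g [x, x - g, x + g * l] := by
    refine isGap_of_mem_of_mem hg (x := x - g) (y := x) (by simp) (by simp) (by ring) ?_
    simp only [List.forall_mem_cons, List.not_mem_nil, IsEmpty.forall_iff, implies_true, and_true]
    exact ⟨⟨1, by ring⟩, ⟨0, by ring⟩, ⟨l + 1, by ring⟩⟩
  have h2 : IsGap d g [x + g, x - g * l, x] := by
    refine isGap_of_mem_of_mem hg (x := x) (y := x + g) (by simp) (by simp) (by ring) ?_
    simp only [List.forall_mem_cons, List.not_mem_nil, IsEmpty.forall_iff, implies_true, and_true]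
    exact ⟨⟨1, by ring⟩, ⟨-l, by ring⟩, ⟨0, by ring⟩⟩
  have h3 : IsGap d g [x, x + g, x - g * l] := by
    refine isGap_of_mem_of_mem hg (x := x) (y := x + g) (by simp) (by simp) (by ring) ?_
    simp only [List.forall_mem_cons, List.not_mem_nil, IsEmpty.forall_iff, implies_true, and_true]
    exact ⟨⟨0, by ring⟩, ⟨1, by ring⟩, ⟨-l, by ring⟩⟩
  have e : x + g - (x - g * l) + x = x - (x - g) + (x + g * l) := by ring
  have h4 := word_triple h2
  rw [e, ← word_triple h1] at h4
  rw [← h4]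
  have h5 := word_triple h3
  have e1 : x - (x + g) + (x - g * l) + g = 2 * x - (x + g * l) := by ring
  have e2 : x - (x + g) + (x - g * l) = 2 * x - (x + g * l) - g := by ring
  rw [e1, e2] at h5
  simp only [← mul_assoc] at h5 ⊢
  rw [h5]

/-- Moving a letter to the front of a word does not change its class modulo `2 g`. -/
theorem exists_word_mul_gen {d g : ℕ} {r : List ℤ} {z : ℤ} (hr : ∀ y ∈ r, (g : ℤ) ∣ y - z) :
    ∃ z', (2 * g : ℤ) ∣ z' - z ∧ word d r * gen d z = gen d z' * word d r := by
  induction r with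
  | nil => exact ⟨z, by simp, by simp⟩
  | cons y r ih =>
    obtain ⟨z', h1, h2⟩ := ih fun y hy => hr y (List.mem_cons_of_mem _ hy)
    refine ⟨2 * y - z', ?_, ?_⟩
    · have h3 := hr y List.mem_cons_self
      obtain ⟨a, ha⟩ := h1
      obtain ⟨b, hb⟩ := h3
      exact ⟨b - a, by linear_combination 2 * hb - ha⟩
    · rw [word_cons, mul_assoc, h2, ← mul_assoc, gen_mul_gen, mul_assoc]

/-! ### Completeness of the invariants -/

/-- The multiset of the letters of `u` modulo `gcd (2 g) d`. -/
def letterClasses (d g : ℕ) (u : List ℤ) : Multiset (ZMod (Nat.gcd (2 * g) d)) :=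
  Multiset.map Int.cast (u : Multiset ℤ)

@[simp] theorem letterClasses_cons (d g : ℕ) (x : ℤ) (u : List ℤ) :
    letterClasses d g (x :: u) = (x : ZMod (Nat.gcd (2 * g) d)) ::ₘ letterClasses d g u := by
  simp [letterClasses]

theorem IsGap.dvd_gcd {d g : ℕ} {u : List ℤ} (h : IsGap d g u) : g ∣ Nat.gcd (2 * g) d :=
  Nat.dvd_gcd (dvd_mul_left _ _) h.dvd

theorem IsGap.letterClasses_eq {d g : ℕ} {u v : List ℤ} (hu : IsGap d g u)
    (h : word d u = word d v) : letterClasses d g u = letterClasses d g v := by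
  obtain ⟨c, hc⟩ := ((hu g).1 dvd_rfl).2
  exact multiset_eq_of_word_eq hu.dvd (Nat.gcd_dvd_right _ _) (Nat.gcd_dvd_left _ _) h hc

theorem word_eq_of_sq_congr {d g n : ℕ} {r s : List ℤ} {x y : ℤ}
    (ih : ∀ u v : List ℤ, u.length = n → v.length = n → IsGap d g u → IsGap d g v →
      letterClasses d g u = letterClasses d g v → (d : ℤ) ∣ altSum u - altSum v →
      word d u = word d v)
    (hn : 3 ≤ n) (hr : (x :: x :: (x - g) :: r).length = n + 1)
    (hs : (y :: y :: (y - g) :: s).length = n + 1)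
    (gr : IsGap d g (x :: x :: (x - g) :: r)) (gs : IsGap d g (y :: y :: (y - g) :: s))
    (hm : letterClasses d g (x :: x :: (x - g) :: r) = letterClasses d g (y :: y :: (y - g) :: s))
    (ha : (d : ℤ) ∣ altSum (x :: x :: (x - g) :: r) - altSum (y :: y :: (y - g) :: s))
    (hxy : (Nat.gcd (2 * g) d : ℤ) ∣ y - x) :
    word d (x :: x :: (x - g) :: r) = word d (y :: y :: (y - g) :: s) := by
  obtain ⟨z, r, rfl⟩ : ∃ z t, r = z :: t := by
    cases r with
    | nil => simp at hr; omega
    | cons z t => exact ⟨z, t, rfl⟩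
  have hz : (g : ℤ) ∣ z - x := gr.dvd_sub (by simp) (by simp)
  -- Bézout: translations by `2g` are available, and those by `d` are free.
  obtain ⟨k, l, hkl⟩ : ∃ k l : ℤ, y = x + k * (2 * g) + d * l := by
    obtain ⟨t, ht⟩ := hxy
    have hb := Nat.gcd_eq_gcd_ab (2 * g) d
    rw [hb] at ht
    push_cast at ht
    exact ⟨Nat.gcdA (2 * g) d * t, Nat.gcdB (2 * g) d * t, by linear_combination ht⟩
  have e : word d (x :: x :: (x - g) :: z :: r) =
      word d (y :: y :: (y - g) :: (z + k * (2 * g)) :: r) := by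
    have h1 : gen d y = gen d (x + k * (2 * g)) := gen_congr ⟨l, by rw [hkl]; ring⟩
    have h2 : gen d (y - g) = gen d (x + k * (2 * g) - g) := gen_congr ⟨l, by rw [hkl]; ring⟩
    have h3 := gen_sq_mul_translate gr.dvd hz k
    simp only [word_cons, h1, h2]
    simp only [← mul_assoc] at h3 ⊢
    rw [h3]
  have gr' := gr.of_word_eq e
  rw [gr.letterClasses_eq e] at hm
  have ha' : (d : ℤ) ∣ altSum (y :: y :: (y - g) :: (z + k * (2 * g)) :: r) -
      altSum (y :: y :: (y - g) :: s) := by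
    have := ha.sub (altSum_eq_of_word_eq e)
    simpa using this
  rw [e, word_cons, word_cons d y]
  congr 1
  -- Deleting one `y` keeps the gap, since `y` and `y - g` both remain.
  have tail : ∀ t, IsGap d g (y :: y :: (y - g) :: t) → IsGap d g (y :: (y - g) :: t) :=
    fun t ht => isGap_of_mem_of_mem ht.dvd (x := y - g) (y := y) (by simp) (by simp) (by ring)
      fun w hw => ht.dvd_sub (List.mem_cons_of_mem _ hw) (by simp)
  refine ih _ _ (by simpa using hr) (by simpa using hs) (tail _ gr') (tail _ gs) ?_ ?_
  · rw [letterClasses_cons d g y (y :: _), letterClasses_cons d g y (y :: _)] at hm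
    exact (Multiset.cons_inj_right _).1 hm
  · rw [altSum_cons y, altSum_cons y (y :: _), sub_sub_sub_cancel_left, dvd_sub_comm] at ha'
    exact ha'

theorem exists_word_eq_sq_of_count {d g : ℕ} {r : List ℤ} {x y : ℤ}
    (gr : IsGap d g (x :: x :: (x - g) :: r)) (hxy : ¬ (Nat.gcd (2 * g) d : ℤ) ∣ y - x)
    (hc : 2 ≤ (letterClasses d g (x :: x :: (x - g) :: r)).count
      (y : ZMod (Nat.gcd (2 * g) d))) :
    ∃ x' r', word d (x :: x :: (x - g) :: r) = word d (x' :: x' :: (x' - g) :: r') ∧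
      (Nat.gcd (2 * g) d : ℤ) ∣ y - x' := by
  have hyx : (y : ZMod (Nat.gcd (2 * g) d)) ≠ x := fun h =>
    hxy ((dvd_sub_comm).1 ((ZMod.intCast_eq_intCast_iff_dvd_sub _ _ _).1 h))
  -- At most one of the two occurrences is `x - g`, so another lies in `r`.
  obtain ⟨z, hz, hzy⟩ : ∃ z ∈ r, (z : ZMod (Nat.gcd (2 * g) d)) = y := by
    have : 0 < (letterClasses d g r).count (y : ZMod (Nat.gcd (2 * g) d)) := by
      simp only [letterClasses_cons] at hc
      rw [Multiset.count_cons_of_ne hyx, Multiset.count_cons_of_ne hyx, Multiset.count_cons] at hc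
      split_ifs at hc <;> omega
    have := Multiset.count_pos.1 this
    simpa [letterClasses] using this
  have hzy' := (ZMod.intCast_eq_intCast_iff_dvd_sub _ _ _).1 hzy
  obtain ⟨r₁, r₂, rfl⟩ := List.append_of_mem hz
  obtain ⟨z', hz', hw⟩ := exists_word_mul_gen (d := d) (g := g) (r := r₁) (z := z) fun w hw =>
    gr.dvd_sub (by simp [hw]) (by simp)
  have hzx : (g : ℤ) ∣ z - x := gr.dvd_sub (by simp) (by simp)
  have hzx' : (g : ℤ) ∣ z' - x := by
    have := ((dvd_mul_left (g : ℤ) 2).trans hz').add hzx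
    simpa using this
  refine ⟨2 * x - z', x :: (r₁ ++ r₂), ?_, ?_⟩
  · have := gen_sq_mul_swap gr.dvd hzx'
    simp only [word_cons, word_append] at this ⊢
    rw [← mul_assoc (word d r₁), hw]
    simp only [← mul_assoc] at this ⊢
    rw [this]
  · have h1 : (Nat.gcd (2 * g) d : ℤ) ∣ 2 * g := by
      exact_mod_cast Int.natCast_dvd_natCast.2 (Nat.gcd_dvd_left (2 * g) d)
    obtain ⟨t, ht⟩ := hzx
    have e : y - (2 * x - z') = (y - z) + (z' - z) + 2 * g * t := by linear_combination 2 * ht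
    rw [e]
    exact (hzy'.add (h1.trans hz')).add (h1.mul_right t)

/-- Words of length at least three with the same invariants represent the same element. -/
theorem word_eq_of_invariants {d g n : ℕ} (hn : 3 ≤ n) : ∀ u v : List ℤ, u.length = n →
    v.length = n → IsGap d g u → IsGap d g v → letterClasses d g u = letterClasses d g v →
    (d : ℤ) ∣ altSum u - altSum v → word d u = word d v := by
  induction n, hn using Nat.le_induction with
  | base =>
    intro u v hu hv gu gv _ ha
    obtain ⟨a, b, c, rfl⟩ := List.length_eq_three.1 hu
    obtain ⟨a', b', c', rfl⟩ := List.length_eq_three.1 hv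
    have h1 := word_triple gu
    have h2 := word_triple gv
    simp only [altSum_cons, altSum_nil] at ha
    have e1 : gen d (a - b + c) = gen d (a' - b' + c') := gen_congr (by convert ha using 1; ring)
    have e2 : gen d (a - b + c + g) = gen d (a' - b' + c' + g) :=
      gen_congr (by convert ha using 1; ring)
    simp only [word_cons, word_nil, mul_one, h1, h2, e1, e2]
  | succ n hn ih =>
    intro u v hu hv gu gv hm ha
    obtain ⟨x, r, hr⟩ := exists_word_eq_sq (by omega) gu
    obtain ⟨y, s, hs⟩ := exists_word_eq_sq (by omega) gv
    have finish : ∀ x r, word d u = word d (x :: x :: (x - g) :: r) →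
        (Nat.gcd (2 * g) d : ℤ) ∣ y - x → word d u = word d v := by
      intro x r hr hxy
      rw [hr, hs]
      refine word_eq_of_sq_congr ih hn ((length_eq_of_word_eq hr).symm.trans hu)
        ((length_eq_of_word_eq hs).symm.trans hv) (gu.of_word_eq hr) (gv.of_word_eq hs) ?_ ?_ hxy
      · rw [← gu.letterClasses_eq hr, ← gv.letterClasses_eq hs, hm]
      · have := (ha.sub (altSum_eq_of_word_eq hr)).add (altSum_eq_of_word_eq hs)
        rwa [show ∀ a b c e : ℤ, a - b - (a - c) + (b - e) = c - e by intros; ring] at this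
    by_cases hxy : (Nat.gcd (2 * g) d : ℤ) ∣ y - x
    · exact finish x r hr hxy
    · obtain ⟨x', r', h1, h2⟩ := exists_word_eq_sq_of_count (gu.of_word_eq hr) hxy (by
        rw [← gu.letterClasses_eq hr, hm, gv.letterClasses_eq hs]
        simp only [letterClasses_cons, Multiset.count_cons_self]
        omega)
      exact finish x' r' (hr.trans h1) h2

/-! ### Values of the invariants and normal words -/

theorem IsGap.pos {d g : ℕ} {u : List ℤ} (hd : 1 ≤ d) (h : IsGap d g u) : 0 < g :=
  Nat.pos_of_dvd_of_pos h.dvd hd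

theorem IsGap.eq {d g h : ℕ} {u : List ℤ} (hg : IsGap d g u) (hh : IsGap d h u) : g = h :=
  Nat.dvd_antisymm ((hh g).2 ((hg g).1 dvd_rfl)) ((hg h).2 ((hh h).1 dvd_rfl))

theorem gcd_two_mul_eq_or {d g : ℕ} (hg : g ∣ d) :
    (2 * g ∣ d ∧ Nat.gcd (2 * g) d = 2 * g) ∨ (¬ 2 * g ∣ d ∧ Nat.gcd (2 * g) d = g) := by
  by_cases h : 2 * g ∣ d
  · exact Or.inl ⟨h, Nat.gcd_eq_left h⟩
  · refine Or.inr ⟨h, ?_⟩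
    obtain ⟨e, rfl⟩ := hg
    rw [mul_comm 2 g, Nat.gcd_mul_left]
    have : ¬ 2 ∣ e := fun ⟨f, hf⟩ => h ⟨f, by rw [hf]; ring⟩
    rw [(Nat.prime_two.coprime_iff_not_dvd.2 this).gcd_eq_one, mul_one]

theorem altSum_congr {g : ℕ} {c : ℤ} : ∀ {u v : List ℤ}, u.length = v.length →
    (∀ x ∈ u, (g : ℤ) ∣ x - c) → (∀ x ∈ v, (g : ℤ) ∣ x - c) →
    (g : ℤ) ∣ u.sum - v.sum ∧ (2 * g : ℤ) ∣ (altSum u - u.sum) - (altSum v - v.sum)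
  | [], [], _, _, _ => by simp
  | [], _ :: _, h, _, _ => by simp at h
  | _ :: _, [], h, _, _ => by simp at h
  | x :: u, y :: v, h, hu, hv => by
    obtain ⟨⟨s, hs⟩, ⟨t, ht⟩⟩ := altSum_congr (u := u) (v := v) (by simpa using h)
      (fun x hx => hu x (List.mem_cons_of_mem _ hx)) (fun x hx => hv x (List.mem_cons_of_mem _ hx))
    obtain ⟨a, ha⟩ := hu x List.mem_cons_self
    obtain ⟨b, hb⟩ := hv y List.mem_cons_self
    simp only [altSum_cons, List.sum_cons]
    exact ⟨⟨a - b + s, by linear_combination ha - hb + hs⟩,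
      ⟨-t - s, by linear_combination -ht - 2 * hs⟩⟩

/-- Changing signs alters the sum by twice a sum of letters, which mod `2g` depends only on the
length and the class mod `g`. Hence only `d / gcd (2g) d` alternating sums are possible for a given
multiset. -/
theorem IsGap.altSum_congr {d g : ℕ} {u v : List ℤ} (hu : IsGap d g u)
    (h : letterClasses d g u = letterClasses d g v) :
    (Nat.gcd (2 * g) d : ℤ) ∣ altSum u - altSum v := by
  have hl : u.length = v.length := by
    simpa [letterClasses] using congrArg Multiset.card h
  obtain ⟨c, hc⟩ := ((hu g).1 dvd_rfl).2
  have hv : ∀ y ∈ v, (g : ℤ) ∣ y - c := by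
    intro y hy
    have : (y : ZMod (Nat.gcd (2 * g) d)) ∈ letterClasses d g u := by
      rw [h]
      simpa [letterClasses] using ⟨y, hy, rfl⟩
    obtain ⟨x, hx, hxy⟩ := (by simpa [letterClasses] using this :
      ∃ x ∈ u, (x : ZMod (Nat.gcd (2 * g) d)) = y)
    have h1 := (ZMod.intCast_eq_intCast_iff_dvd_sub _ _ _).1 hxy
    have h2 := ((Int.natCast_dvd_natCast.2 hu.dvd_gcd).trans h1).add (hc x hx)
    simpa using h2
  obtain ⟨_, h2⟩ := YangBaxterGrowth.altSum_congr hl hc hv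
  have h3 : (Nat.gcd (2 * g) d : ℤ) ∣ u.sum - v.sum := by
    have := congrArg Multiset.sum h
    simp only [letterClasses, Multiset.map_coe, Multiset.sum_coe, ← Int.cast_list_sum] at this
    exact dvd_sub_comm.1 ((ZMod.intCast_eq_intCast_iff_dvd_sub _ _ _).1 this)
  have h4 : (Nat.gcd (2 * g) d : ℤ) ∣ 2 * g := by
    exact_mod_cast Int.natCast_dvd_natCast.2 (Nat.gcd_dvd_left (2 * g) d)
  have := (h4.trans h2).add h3
  rwa [show ∀ a b c e : ℤ, a - b - (c - e) + (b - e) = a - c by intros; ring] at this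

/-- Representatives of the elements of length `m + 3`: they are determined by the gap `g`, the
class `a` modulo `g`, the number of letters in the class `a` modulo `2 g`, and the alternating
sum. -/
def normalWord (d m g a s k : ℕ) : List ℤ :=
  (a : ℤ) :: (a + g : ℤ) ::
    (List.replicate s (a : ℤ) ++ List.replicate (m + 1 - s) (a + g : ℤ)).modifyHead
      (· + (Nat.gcd (2 * g) d : ℤ) * k)

theorem exists_normalWord_eq (d m g a s : ℕ) : ∃ h t,
    h :: t = List.replicate s (a : ℤ) ++ List.replicate (m + 1 - s) (a + g : ℤ) ∧
    ∀ k, normalWord d m g a s k = (a : ℤ) :: (a + g : ℤ) ::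
      (h + (Nat.gcd (2 * g) d : ℤ) * k) :: t := by
  unfold normalWord
  generalize hT : List.replicate s (a : ℤ) ++ List.replicate (m + 1 - s) (a + g : ℤ) = T
  cases T with
  | nil =>
    have := congrArg List.length hT
    simp at this
    omega
  | cons h t => exact ⟨h, t, rfl, fun k => rfl⟩

theorem length_normalWord {d m g a s k : ℕ} (hs : s ≤ m + 1) :
    (normalWord d m g a s k).length = m + 3 := by
  simp [normalWord]
  omega

theorem isGap_normalWord {d m g a s k : ℕ} (hg : g ∣ d) : IsGap d g (normalWord d m g a s k) := by
  obtain ⟨h, t, hT, e⟩ := exists_normalWord_eq d m g a s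
  have hall : ∀ z ∈ h :: t, (g : ℤ) ∣ z - a := by
    rw [hT]
    intro z hz
    rcases List.mem_append.1 hz with hz | hz
    · rw [List.eq_of_mem_replicate hz]; simp
    · rw [List.eq_of_mem_replicate hz]; simp
  rw [e]
  refine isGap_of_mem_of_mem hg (x := a) (y := a + g) (by simp) (by simp) (by ring) ?_
  simp only [List.forall_mem_cons] at hall ⊢
  refine ⟨by simp, by simp, ?_, hall.2⟩
  rw [add_sub_right_comm]
  exact hall.1.add ((Int.natCast_dvd_natCast.2 (Nat.dvd_gcd (dvd_mul_left _ _) hg)).mul_right _)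

theorem letterClasses_normalWord (d m g a s k : ℕ) :
    letterClasses d g (normalWord d m g a s k) = ((a : ℤ) : ZMod (Nat.gcd (2 * g) d)) ::ₘ
      ((a + g : ℤ) : ZMod (Nat.gcd (2 * g) d)) ::ₘ
      (Multiset.replicate s ((a : ℤ) : ZMod (Nat.gcd (2 * g) d)) +
        Multiset.replicate (m + 1 - s) ((a + g : ℤ) : ZMod (Nat.gcd (2 * g) d))) := by
  obtain ⟨h, t, hT, e⟩ := exists_normalWord_eq d m g a s
  have h1 : letterClasses d g ((h + (Nat.gcd (2 * g) d : ℤ) * k) :: t) =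
      letterClasses d g (h :: t) := by
    have : ((Nat.gcd (2 * g) d : ℕ) : ZMod (Nat.gcd (2 * g) d)) = 0 := ZMod.natCast_self _
    rw [letterClasses_cons, letterClasses_cons, Int.cast_add, Int.cast_mul, Int.cast_natCast, this,
      zero_mul, add_zero]
  rw [e, letterClasses_cons, letterClasses_cons, h1, hT]
  simp only [letterClasses, ← Multiset.coe_add, Multiset.map_add, Multiset.coe_replicate,
    Multiset.map_replicate]

theorem altSum_normalWord (d m g a s k : ℕ) : altSum (normalWord d m g a s k) =
    altSum (normalWord d m g a s 0) + (Nat.gcd (2 * g) d : ℤ) * k := by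
  obtain ⟨h, t, hT, e⟩ := exists_normalWord_eq d m g a s
  rw [e, e]
  simp only [altSum_cons]
  push_cast
  ring

theorem natCast_ne_add_gap {d g a : ℕ} (hg : g ∣ d) (hq : Nat.gcd (2 * g) d ≠ g) :
    ((a : ℤ) : ZMod (Nat.gcd (2 * g) d)) ≠ ((a + g : ℤ) : ZMod (Nat.gcd (2 * g) d)) := by
  intro h
  have h1 := (ZMod.intCast_eq_intCast_iff_dvd_sub _ _ _).1 h
  rw [add_sub_cancel_left] at h1
  exact hq (Nat.dvd_antisymm (Int.natCast_dvd_natCast.1 h1) (Nat.dvd_gcd (dvd_mul_left _ _) hg))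

theorem normalWord_injective {d m g a s k g' a' s' k' : ℕ} (hd : 1 ≤ d) (hg : g ∣ d) (hg' : g' ∣ d)
    (ha : a < g) (ha' : a' < g') (hs : Nat.gcd (2 * g) d = g → s = 0)
    (hs' : Nat.gcd (2 * g') d = g' → s' = 0) (hk : k < d / Nat.gcd (2 * g) d)
    (hk' : k' < d / Nat.gcd (2 * g') d)
    (h : word d (normalWord d m g a s k) = word d (normalWord d m g' a' s' k')) :
    g = g' ∧ a = a' ∧ s = s' ∧ k = k' := by
  have gap := isGap_normalWord (m := m) (a := a) (s := s) (k := k) hg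
  have gap' := isGap_normalWord (m := m) (a := a') (s := s') (k := k') hg'
  obtain rfl := (gap.of_word_eq h).eq gap'
  have hall := forall_dvd_of_word_eq (c := a) hg h fun x hx =>
    gap.dvd_sub hx (by simp [normalWord])
  have haa : (g : ℤ) ∣ a' - a := hall a' (by simp [normalWord])
  obtain rfl : a = a' := by
    obtain ⟨t, ht⟩ := haa
    have ht0 : t = 0 := by
      have h1 : (g : ℤ) * t < g * 1 := by rw [← ht]; omega
      have h2 : (g : ℤ) * (-1) < g * t := by rw [← ht]; omega
      have hg0 : (0 : ℤ) < g := by omega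
      have := lt_of_mul_lt_mul_left h1 hg0.le
      have := lt_of_mul_lt_mul_left h2 hg0.le
      omega
    rw [ht0] at ht
    omega
  have hss : s = s' := by
    by_cases hq : Nat.gcd (2 * g) d = g
    · rw [hs hq, hs' hq]
    · have hm := gap.letterClasses_eq h
      rw [letterClasses_normalWord, letterClasses_normalWord] at hm
      have hc := congrArg (Multiset.count ((a : ℤ) : ZMod (Nat.gcd (2 * g) d))) hm
      have hne := natCast_ne_add_gap (a := a) hg hq
      simpa only [Multiset.count_cons_self, Multiset.count_cons_of_ne hne, Multiset.count_add,
        Multiset.count_replicate_self, Multiset.count_replicate, if_neg hne.symm, add_zero,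
        add_left_inj] using hc
  subst hss
  refine ⟨rfl, rfl, rfl, ?_⟩
  have hP := altSum_eq_of_word_eq h
  rw [altSum_normalWord, altSum_normalWord d m g a s k', add_sub_add_left_eq_sub, ← mul_sub] at hP
  obtain ⟨e, he⟩ := Nat.gcd_dvd_right (2 * g) d
  have hq0 : 0 < Nat.gcd (2 * g) d := Nat.gcd_pos_of_pos_right _ hd
  rw [Nat.div_eq_of_eq_mul_right hq0 he] at hk hk'
  have hP' : ((Nat.gcd (2 * g) d : ℕ) : ℤ) * e ∣ (Nat.gcd (2 * g) d : ℕ) * ((k : ℤ) - k') := by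
    convert hP using 1
    exact_mod_cast he.symm
  have h3 := (mul_dvd_mul_iff_left (by exact_mod_cast hq0.ne')).1 hP'
  have h4 := Int.eq_zero_of_abs_lt_dvd h3 (by rw [abs_lt]; omega)
  omega

theorem letterClasses_eq_of_isGap {d g m : ℕ} {u : List ℤ} (hu : u.length = m + 3)
    (h : IsGap d g u) {a : ℕ} (ha : ∀ x ∈ u, (g : ℤ) ∣ x - a) :
    ∃ s < if Nat.gcd (2 * g) d = g then 1 else m + 2,
      letterClasses d g u = letterClasses d g (normalWord d m g a s 0) := by
  have hgq := h.dvd_gcd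
  have hcard : (letterClasses d g u).card = m + 3 := by simpa [letterClasses] using hu
  by_cases hq : Nat.gcd (2 * g) d = g
  · refine ⟨0, by simp [hq], ?_⟩
    have hag : ((a + g : ℤ) : ZMod (Nat.gcd (2 * g) d)) = ((a : ℤ) : ZMod (Nat.gcd (2 * g) d)) := by
      rw [eq_comm, ZMod.intCast_eq_intCast_iff_dvd_sub, add_sub_cancel_left, hq]
    rw [letterClasses_normalWord, hag, Multiset.replicate_zero, zero_add,
      ← Multiset.replicate_succ, ← Multiset.replicate_succ, Multiset.eq_replicate]
    refine ⟨hcard, ?_⟩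
    intro b hb
    obtain ⟨x, hx, rfl⟩ := (by simpa [letterClasses] using hb :
      ∃ x ∈ u, (x : ZMod (Nat.gcd (2 * g) d)) = b)
    rw [eq_comm, ZMod.intCast_eq_intCast_iff_dvd_sub, hq]
    exact ha x hx
  · have hq2 : Nat.gcd (2 * g) d = 2 * g := by
      rcases gcd_two_mul_eq_or h.dvd with h' | h'
      · exact h'.2
      · exact absurd h'.2 hq
    have hne := natCast_ne_add_gap (a := a) h.dvd hq
    have hcls : ∀ b ∈ letterClasses d g u, b = ((a : ℤ) : ZMod (Nat.gcd (2 * g) d)) ∨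
        b = ((a + g : ℤ) : ZMod (Nat.gcd (2 * g) d)) := by
      intro b hb
      obtain ⟨x, hx, rfl⟩ := (by simpa [letterClasses] using hb :
        ∃ x ∈ u, (x : ZMod (Nat.gcd (2 * g) d)) = b)
      obtain ⟨t, ht⟩ := ha x hx
      rw [eq_comm, ZMod.intCast_eq_intCast_iff_dvd_sub, eq_comm, ZMod.intCast_eq_intCast_iff_dvd_sub,
        hq2]
      push_cast
      rcases Int.even_or_odd' t with ⟨r, rfl | rfl⟩
      · exact Or.inl ⟨r, by rw [ht]; ring⟩
      · exact Or.inr ⟨r, by linear_combination ht⟩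
    have hmem : ∀ b c : ZMod (Nat.gcd (2 * g) d), (∀ y ∈ letterClasses d g u, y = b ∨ y = c) →
        c ∈ letterClasses d g u := by
      intro b c hbc
      by_contra hcu
      have hall : ∀ x ∈ u, (x : ZMod (Nat.gcd (2 * g) d)) = b := by
        intro x hx
        have hx' : (x : ZMod (Nat.gcd (2 * g) d)) ∈ letterClasses d g u := by
          simpa [letterClasses] using ⟨x, hx, rfl⟩
        rcases hbc _ hx' with h1 | h1
        · exact h1
        · exact absurd (h1 ▸ hx') hcu
      obtain ⟨z, rfl⟩ := ZMod.intCast_surjective b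
      -- If one class were missing, all letters would agree mod `2g`, against the maximality of the
      -- gap.
      have : Nat.gcd (2 * g) d ∣ g := (h _).2 ⟨Nat.gcd_dvd_right _ _, z, fun x hx =>
        (ZMod.intCast_eq_intCast_iff_dvd_sub _ _ _).1 (hall x hx).symm⟩
      exact hq (Nat.dvd_antisymm this hgq)
    obtain ⟨M, hM⟩ := Multiset.exists_cons_of_mem (hmem _ _ fun y hy => (hcls y hy).symm)
    have h2 := hmem _ _ hcls
    rw [hM, Multiset.mem_cons] at h2
    obtain ⟨N, hN⟩ := Multiset.exists_cons_of_mem (h2.resolve_left hne.symm)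
    rw [hN] at hM
    have hNcard : N.card = m + 1 := by
      rw [hM] at hcard
      simpa using hcard
    have hs : N.count ((a : ℤ) : ZMod (Nat.gcd (2 * g) d)) ≤ m + 1 := hNcard ▸ N.count_le_card _
    refine ⟨N.count ((a : ℤ) : ZMod (Nat.gcd (2 * g) d)), by rw [if_neg hq]; omega, ?_⟩
    rw [letterClasses_normalWord, hM]
    congr 2
    have hNf := Multiset.filter_add_not (· = ((a : ℤ) : ZMod (Nat.gcd (2 * g) d))) N
    have h3 : N.filter (fun y => ¬ y = ((a : ℤ) : ZMod (Nat.gcd (2 * g) d))) =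
        Multiset.replicate (m + 1 - N.count ((a : ℤ) : ZMod (Nat.gcd (2 * g) d)))
          ((a + g : ℤ) : ZMod (Nat.gcd (2 * g) d)) := by
      rw [Multiset.eq_replicate]
      constructor
      · have := congrArg Multiset.card hNf
        rw [Multiset.card_add, Multiset.filter_eq', Multiset.card_replicate, hNcard] at this
        omega
      · intro b hb
        rw [Multiset.mem_filter] at hb
        refine (hcls b ?_).resolve_left hb.2
        rw [hM]
        exact Multiset.mem_cons_of_mem (Multiset.mem_cons_of_mem hb.1)
    rw [Multiset.filter_eq', h3] at hNf
    exact hNf.symm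

theorem exists_normalWord {d m : ℕ} (hd : 1 ≤ d) {u : List ℤ} (hu : u.length = m + 3) :
    ∃ g a s k, g ∣ d ∧ a < g ∧ (s < if Nat.gcd (2 * g) d = g then 1 else m + 2) ∧
      k < d / Nat.gcd (2 * g) d ∧ word d (normalWord d m g a s k) = word d u := by
  have hne : u ≠ [] := by rintro rfl; simp at hu
  obtain ⟨g, hg⟩ := exists_isGap d hne
  obtain ⟨x, v, rfl⟩ := List.exists_cons_of_ne_nil hne
  have hg0 : 0 < g := hg.pos hd
  obtain ⟨a, hax⟩ : ∃ a : ℕ, (a : ℤ) = x % g :=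
    ⟨(x % g).toNat, Int.toNat_of_nonneg (Int.emod_nonneg _ (by omega))⟩
  have hag : a < g := by
    have := Int.emod_lt_of_pos x (by omega : (0 : ℤ) < g)
    omega
  have ha : ∀ y ∈ x :: v, (g : ℤ) ∣ y - a := by
    intro y hy
    have h1 := hg.dvd_sub hy List.mem_cons_self
    have h2 : (g : ℤ) ∣ x - a := by
      rw [hax]
      exact Int.dvd_self_sub_emod
    simpa using h1.add h2
  obtain ⟨s, hs, hm⟩ := letterClasses_eq_of_isGap hu hg ha
  have hq0 : 0 < Nat.gcd (2 * g) d := Nat.gcd_pos_of_pos_right _ hd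
  obtain ⟨e, he⟩ := Nat.gcd_dvd_right (2 * g) d
  have he0 : 0 < e := by
    rcases Nat.eq_zero_or_pos e with h | h
    · rw [h, mul_zero] at he; omega
    · exact h
  obtain ⟨t, ht⟩ := hg.altSum_congr hm
  obtain ⟨k, hk⟩ : ∃ k : ℕ, (k : ℤ) = t % e :=
    ⟨(t % e).toNat, Int.toNat_of_nonneg (Int.emod_nonneg _ (by omega))⟩
  have hke : k < e := by
    have := Int.emod_lt_of_pos t (by omega : (0 : ℤ) < e)
    omega
  refine ⟨g, a, s, k, hg.dvd, hag, hs, by rwa [Nat.div_eq_of_eq_mul_right hq0 he], ?_⟩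
  have hs' : s ≤ m + 1 := by
    split_ifs at hs <;> omega
  refine word_eq_of_invariants (n := m + 3) (by omega) _ _ (length_normalWord hs') hu
    (isGap_normalWord hg.dvd) hg ?_ ?_
  · rw [hm, letterClasses_normalWord, letterClasses_normalWord]
  · obtain ⟨r, hr⟩ : (e : ℤ) ∣ t - k := by
      rw [hk]
      exact Int.dvd_self_sub_emod
    have he' : (d : ℤ) = (Nat.gcd (2 * g) d : ℕ) * e := by exact_mod_cast he
    rw [altSum_normalWord]
    refine ⟨-r, ?_⟩
    rw [he']
    linear_combination -ht - (Nat.gcd (2 * g) d : ℤ) * hr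

/-! ### Counting elements of each length -/

theorem ncard_pow_add_three {d : ℕ} (hd : 1 ≤ d) (m : ℕ) :
    (standardGenerators (reflectionSolution d) ^ (m + 3)).ncard = ∑ g ∈ d.divisors,
      g * ((if Nat.gcd (2 * g) d = g then 1 else m + 2) * (d / Nat.gcd (2 * g) d)) := by
  let I : Finset (Σ _ : ℕ, ℕ × ℕ × ℕ) := d.divisors.sigma fun g =>
    Finset.range g ×ˢ (Finset.range (if Nat.gcd (2 * g) d = g then 1 else m + 2) ×ˢ
      Finset.range (d / Nat.gcd (2 * g) d))
  let f : (Σ _ : ℕ, ℕ × ℕ × ℕ) → StructureMonoid (reflectionSolution d) := fun p =>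
    word d (normalWord d m p.1 p.2.1 p.2.2.1 p.2.2.2)
  have hI : ∀ p, p ∈ I ↔ p.1 ∣ d ∧ p.2.1 < p.1 ∧
      (p.2.2.1 < if Nat.gcd (2 * p.1) d = p.1 then 1 else m + 2) ∧
      p.2.2.2 < d / Nat.gcd (2 * p.1) d := by
    intro p
    simp only [I, Finset.mem_sigma, Nat.mem_divisors, Finset.mem_product, Finset.mem_range]
    have : d ≠ 0 := by omega
    tauto
  have himg : standardGenerators (reflectionSolution d) ^ (m + 3) = f '' I := by
    rw [standardGenerators_pow]
    ext x
    constructor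
    · rintro ⟨u, hu, rfl⟩
      obtain ⟨g, a, s, k, h1, h2, h3, h4, h5⟩ := exists_normalWord hd hu
      exact ⟨⟨g, a, s, k⟩, (hI _).2 ⟨h1, h2, h3, h4⟩, h5⟩
    · rintro ⟨⟨g, a, s, k⟩, hp, rfl⟩
      obtain ⟨-, -, h3, -⟩ := (hI _).1 hp
      have hs : s ≤ m + 1 := by
        dsimp only at h3
        split_ifs at h3 <;> omega
      exact ⟨_, length_normalWord hs, rfl⟩
  have hinj : Set.InjOn f I := by
    rintro ⟨g, a, s, k⟩ hp ⟨g', a', s', k'⟩ hp' h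
    obtain ⟨h1, h2, h3, h4⟩ := (hI _).1 hp
    obtain ⟨h1', h2', h3', h4'⟩ := (hI _).1 hp'
    dsimp only at h1 h2 h3 h4 h1' h2' h3' h4'
    have hs : Nat.gcd (2 * g) d = g → s = 0 := fun e => by
      rw [if_pos e] at h3
      exact Nat.lt_one_iff.1 h3
    have hs' : Nat.gcd (2 * g') d = g' → s' = 0 := fun e => by
      rw [if_pos e] at h3'
      exact Nat.lt_one_iff.1 h3'
    obtain ⟨rfl, rfl, rfl, rfl⟩ := normalWord_injective hd h1 h1' h2 h2' hs hs' h4 h4' h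
    rfl
  rw [himg, hinj.ncard_image, Set.ncard_coe_finset, Finset.card_sigma]
  simp only [Finset.card_product, Finset.card_range]

theorem isGap_pair (d : ℕ) (a δ : ℕ) : IsGap d (Nat.gcd d δ) [(a : ℤ), a + δ] := by
  rw [isGap_iff_of_mem (x := (a : ℤ)) (by simp)]
  intro k
  rw [Nat.dvd_gcd_iff]
  simp [Int.natCast_dvd_natCast]

theorem ncard_pow_two {d : ℕ} (hd : 1 ≤ d) :
    (standardGenerators (reflectionSolution d) ^ 2).ncard = ∑ δ ∈ Finset.range d, Nat.gcd d δ := by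
  let I : Finset (Σ _ : ℕ, ℕ) := (Finset.range d).sigma fun δ => Finset.range (Nat.gcd d δ)
  let f : (Σ _ : ℕ, ℕ) → StructureMonoid (reflectionSolution d) := fun p =>
    word d [(p.2 : ℤ), p.2 + p.1]
  have hI : ∀ p, p ∈ I ↔ p.1 < d ∧ p.2 < Nat.gcd d p.1 := by
    intro p
    simp only [I, Finset.mem_sigma, Finset.mem_range]
  have himg : standardGenerators (reflectionSolution d) ^ 2 = f '' I := by
    rw [standardGenerators_pow]
    ext x
    constructor
    · rintro ⟨u, hu, rfl⟩
      obtain ⟨i, j, rfl⟩ := List.length_eq_two.1 hu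
      have hd0 : (0 : ℤ) < d := by omega
      obtain ⟨δ, hδ⟩ : ∃ δ : ℕ, (δ : ℤ) = (j - i) % d :=
        ⟨((j - i) % d).toNat, Int.toNat_of_nonneg (Int.emod_nonneg _ hd0.ne')⟩
      have hδd : δ < d := by
        have := Int.emod_lt_of_pos (j - i) hd0
        omega
      have hg0 : 0 < Nat.gcd d δ := Nat.gcd_pos_of_pos_left _ hd
      obtain ⟨a, ha⟩ : ∃ a : ℕ, (a : ℤ) = i % (Nat.gcd d δ : ℕ) :=
        ⟨(i % (Nat.gcd d δ : ℕ)).toNat, Int.toNat_of_nonneg (Int.emod_nonneg _ (by omega))⟩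
      have hag : a < Nat.gcd d δ := by
        have := Int.emod_lt_of_pos i (by omega : (0 : ℤ) < (Nat.gcd d δ : ℕ))
        omega
      refine ⟨⟨δ, a⟩, (hI _).2 ⟨hδd, hag⟩, ?_⟩
      obtain ⟨s, hs⟩ : (d : ℤ) ∣ j - i - δ := by
        rw [hδ]
        exact Int.dvd_self_sub_emod
      obtain ⟨t, ht⟩ : ((Nat.gcd d δ : ℕ) : ℤ) ∣ i - a := by
        rw [ha]
        exact Int.dvd_self_sub_emod
      rw [Nat.gcd_eq_gcd_ab] at ht
      simp only [f, word_cons, word_nil, mul_one]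
      -- By Bézout, shifts by `δ` realise every translation by `gcd d δ` modulo `d`.
      rw [← gen_mul_gen_shift d (a : ℤ) (a + δ) (Nat.gcdB d δ * t)]
      congr 1
      · exact gen_congr ⟨-(Nat.gcdA d δ * t), by linear_combination -ht⟩
      · exact gen_congr ⟨-(Nat.gcdA d δ * t) - s, by linear_combination -ht - hs⟩
    · rintro ⟨⟨δ, a⟩, hp, rfl⟩
      exact ⟨_, rfl, rfl⟩
  have hinj : Set.InjOn f I := by
    rintro ⟨δ, a⟩ hp ⟨δ', a'⟩ hp' h
    obtain ⟨h1, h2⟩ := (hI _).1 hp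
    obtain ⟨h1', h2'⟩ := (hI _).1 hp'
    dsimp only at h1 h2 h1' h2'
    have hP := altSum_eq_of_word_eq h
    simp only [altSum_cons, altSum_nil] at hP
    obtain rfl : δ = δ' := by
      have := Int.eq_zero_of_abs_lt_dvd (x := (δ' : ℤ) - δ) (by convert hP using 1; ring)
        (by rw [abs_lt]; omega)
      omega
    have h3 := forall_dvd_of_word_eq (c := a) (Nat.gcd_dvd_left d δ) h fun x hx =>
      (isGap_pair d a δ).dvd_sub hx (by simp)
    have h4 := Int.eq_zero_of_abs_lt_dvd (h3 a' (by simp)) (by rw [abs_lt]; omega)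
    obtain rfl : a = a' := by omega
    rfl
  rw [himg, hinj.ncard_image, Set.ncard_coe_finset, Finset.card_sigma]
  simp only [Finset.card_range]

theorem ncard_pow_one {d : ℕ} (hd : 1 ≤ d) :
    (standardGenerators (reflectionSolution d) ^ 1).ncard = d := by
  have himg : standardGenerators (reflectionSolution d) ^ 1 =
      (fun i : ℕ => gen d i) '' (Finset.range d : Set ℕ) := by
    rw [pow_one, standardGenerators_eq]
    ext x
    constructor
    · rintro ⟨i, rfl⟩
      have hd0 : (0 : ℤ) < d := by omega
      refine ⟨(i % d).toNat, ?_, gen_congr ?_⟩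
      · have := Int.emod_lt_of_pos i hd0
        have := Int.emod_nonneg i hd0.ne'
        simp only [Finset.coe_range, Set.mem_Iio]
        omega
      · rw [Int.toNat_of_nonneg (Int.emod_nonneg i hd0.ne'), dvd_sub_comm]
        exact Int.dvd_self_sub_emod
    · rintro ⟨i, -, rfl⟩
      exact ⟨i, rfl⟩
  have hinj : Set.InjOn (fun i : ℕ => gen d i) (Finset.range d : Set ℕ) := by
    intro i hi j hj h
    simp only [Finset.coe_range, Set.mem_Iio] at hi hj
    have hP := altSum_eq_of_word_eq (u := [(i : ℤ)]) (v := [(j : ℤ)]) (by simpa using h)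
    simp only [altSum_cons, altSum_nil, sub_zero] at hP
    have := Int.eq_zero_of_abs_lt_dvd hP (by rw [abs_lt]; omega)
    omega
  rw [himg, hinj.ncard_image, Set.ncard_coe_finset, Finset.card_range]

/-- The relations are homogeneous, so products of different lengths never coincide and nothing is
subtracted. -/
theorem coeff_growthSeries (d n : ℕ) :
    PowerSeries.coeff n (growthSeries (standardGenerators (reflectionSolution d))) =
      ((standardGenerators (reflectionSolution d) ^ n).ncard : ℚ) := by
  rw [growthSeries, PowerSeries.coeff_mk, sdiff_eq_left.2]
  simp only [Set.disjoint_iUnion_right]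
  intro i hi
  rw [Set.disjoint_left]
  simp only [standardGenerators_pow]
  rintro _ ⟨u, hu, rfl⟩ ⟨v, hv, h⟩
  have := length_eq_of_word_eq h
  omega

/-! ### Divisor sums and power series -/

theorem sum_gcd_eq (d : ℕ) (hd : 1 ≤ d) : ((∑ δ ∈ Finset.range d, Nat.gcd d δ : ℕ) : ℚ) =
    d * ∑ c ∈ d.divisors, (Nat.totient c : ℚ) / c := by
  have h1 : ∑ δ ∈ Finset.range d, Nat.gcd d δ = ∑ e ∈ d.divisors, e * Nat.totient (d / e) := by
    rw [← Finset.sum_fiberwise_of_maps_to (s := Finset.range d) (t := d.divisors)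
      (g := fun δ => Nat.gcd d δ)
      (fun δ _ => Nat.mem_divisors.2 ⟨Nat.gcd_dvd_left _ _, by omega⟩)]
    refine Finset.sum_congr rfl fun e he => ?_
    -- Exactly `φ(d/e)` residues have gcd `e` with `d`.
    rw [Nat.totient_div_of_dvd (Nat.dvd_of_mem_divisors he), Finset.sum_congr rfl
      (fun δ hδ => (Finset.mem_filter.1 hδ).2), Finset.sum_const, smul_eq_mul, mul_comm]
  rw [h1, ← Nat.sum_div_divisors d (fun e => e * Nat.totient (d / e)), Finset.mul_sum]
  push_cast
  refine Finset.sum_congr rfl fun c hc => ?_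
  obtain ⟨e, rfl⟩ := Nat.dvd_of_mem_divisors hc
  have hc0 : 0 < c := Nat.pos_of_mul_pos_right hd
  have he0 : 0 < e := Nat.pos_of_mul_pos_left hd
  rw [Nat.mul_div_cancel_left _ hc0, Nat.mul_div_cancel _ he0]
  push_cast
  field_simp

theorem numDivisors_natCast (a : ℕ) : numDivisors (a : ℚ) = a.divisors.card := by
  rcases Nat.eq_zero_or_pos a with rfl | h
  · simp [numDivisors]
  · simp [numDivisors, h]

theorem numDivisors_half {d : ℕ} (hd : 1 ≤ d) :
    numDivisors ((d : ℚ) / 2) = (d.divisors.filter (2 * · ∣ d)).card := by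
  by_cases h : 2 ∣ d
  · obtain ⟨e, rfl⟩ := h
    have : ((2 * e : ℕ) : ℚ) / 2 = e := by push_cast; ring
    rw [this, numDivisors_natCast]
    congr 1
    ext g
    simp only [Nat.mem_divisors, Finset.mem_filter, Nat.mul_dvd_mul_iff_left two_pos]
    constructor
    · rintro ⟨h1, h2⟩
      exact ⟨⟨h1.mul_left 2, by omega⟩, h1⟩
    · rintro ⟨⟨_, h2⟩, h1⟩
      exact ⟨h1, by omega⟩
  · have h1 : ¬ ((d : ℚ) / 2).den = 1 := by
      intro h1
      apply h
      have h2 := Rat.den_eq_one_iff _ |>.1 h1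
      have h3 : (d : ℚ) = 2 * (((d : ℚ) / 2).num : ℚ) := by rw [h2]; ring
      have h4 : (d : ℤ) = 2 * ((d : ℚ) / 2).num := by exact_mod_cast h3
      exact Int.natCast_dvd_natCast.1 ⟨_, h4⟩
    rw [numDivisors, if_neg (fun h2 => h1 h2.2), eq_comm, Finset.card_eq_zero,
      Finset.filter_eq_empty_iff]
    intro g _ hg
    exact h ((dvd_mul_right 2 g).trans hg)

theorem sum_divisors_eq {d : ℕ} (hd : 1 ≤ d) (m : ℕ) : ((∑ g ∈ d.divisors,
      g * ((if Nat.gcd (2 * g) d = g then 1 else m + 2) * (d / Nat.gcd (2 * g) d)) : ℕ) : ℚ) =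
    d * (numDivisors (d : ℚ) + numDivisors ((d : ℚ) / 2) * (m / 2)) := by
  rw [numDivisors_natCast, numDivisors_half hd]
  have h : ∀ g ∈ d.divisors, ((g * ((if Nat.gcd (2 * g) d = g then 1 else m + 2) *
      (d / Nat.gcd (2 * g) d)) : ℕ) : ℚ) = d + if 2 * g ∣ d then d * ((m : ℚ) / 2) else 0 := by
    intro g hg
    have hgd := Nat.dvd_of_mem_divisors hg
    have hg0 : 0 < g := Nat.pos_of_dvd_of_pos hgd hd
    rcases gcd_two_mul_eq_or hgd with ⟨h1, h2⟩ | ⟨h1, h2⟩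
    · rw [h2, if_neg (by omega), if_pos h1]
      obtain ⟨e, rfl⟩ := h1
      rw [Nat.mul_div_cancel_left _ (by omega)]
      push_cast
      ring
    · rw [h2, if_pos rfl, if_neg h1, one_mul, Nat.mul_div_cancel' hgd, add_zero]
  rw [Nat.cast_sum, Finset.sum_congr rfl h, Finset.sum_add_distrib, ← Finset.sum_filter]
  simp only [Finset.sum_const, nsmul_eq_mul]
  ring

theorem inv_one_sub_X : (1 - PowerSeries.X : PowerSeries ℚ)⁻¹ = PowerSeries.mk fun _ => 1 := by
  rw [eq_comm, PowerSeries.eq_inv_iff_mul_eq_one (by simp)]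
  exact PowerSeries.mk_one_mul_one_sub_eq_one ℚ

theorem X_mul_inv_two_mul_sq :
    (PowerSeries.X : PowerSeries ℚ) * (2 * (1 - PowerSeries.X) ^ 2)⁻¹ =
      PowerSeries.mk fun n => (n : ℚ) / 2 := by
  have h2 : PowerSeries.constantCoeff (2 * (1 - PowerSeries.X) ^ 2 : PowerSeries ℚ) ≠ 0 := by
    rw [show (2 : PowerSeries ℚ) = PowerSeries.C 2 from (map_ofNat _ 2).symm]
    simp
  rw [eq_comm, PowerSeries.eq_mul_inv_iff_mul_eq h2]
  have h : (PowerSeries.mk fun n => (n : ℚ) / 2) * (1 - PowerSeries.X) =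
      PowerSeries.C (1 / 2 : ℚ) * (PowerSeries.X * PowerSeries.mk fun _ => 1) := by
    ext n
    rw [mul_sub, mul_one, map_sub, PowerSeries.coeff_C_mul]
    cases n with
    | zero => simp
    | succ n =>
      rw [PowerSeries.coeff_succ_mul_X, PowerSeries.coeff_succ_X_mul]
      simp only [PowerSeries.coeff_mk]
      push_cast
      ring
  have h3 : (2 : PowerSeries ℚ) * PowerSeries.C (1 / 2 : ℚ) = 1 := by
    rw [show (2 : PowerSeries ℚ) = PowerSeries.C 2 from (map_ofNat _ 2).symm, ← map_mul]
    norm_num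
  have h4 := PowerSeries.mk_one_mul_one_sub_eq_one ℚ
  linear_combination (2 * (1 - PowerSeries.X)) * h +
    (PowerSeries.X * (PowerSeries.mk fun _ => (1 : ℚ)) * (1 - PowerSeries.X)) * h3
    + PowerSeries.X * h4

end YangBaxterGrowth

theorem mainTheorem10 (d : ℕ) (hd : 1 ≤ d) :
    YangBaxterGrowth.growthSeries
        (YangBaxterGrowth.standardGenerators (YangBaxterGrowth.reflectionSolution d)) =
      1 + PowerSeries.C (d : ℚ) *
        (PowerSeries.X
          + PowerSeries.C (∑ c ∈ Nat.divisors d, (Nat.totient c : ℚ) / (c : ℚ))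
              * PowerSeries.X ^ 2
          + PowerSeries.C (YangBaxterGrowth.numDivisors (d : ℚ) : ℚ)
              * (PowerSeries.X ^ 3 * (1 - PowerSeries.X)⁻¹)
          + PowerSeries.C (YangBaxterGrowth.numDivisors ((d : ℚ) / 2) : ℚ)
              * (PowerSeries.X ^ 4 * (2 * (1 - PowerSeries.X) ^ 2)⁻¹)) := by
  -- Pulling out `X ^ 3` makes the coefficient at `m + 3` equal to `m / 2`, as in `sum_divisors_eq`.
  have h4 : (PowerSeries.X : PowerSeries ℚ) ^ 4 * (2 * (1 - PowerSeries.X) ^ 2)⁻¹ =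
      PowerSeries.X ^ 3 * PowerSeries.mk fun n => (n : ℚ) / 2 := by
    rw [← YangBaxterGrowth.X_mul_inv_two_mul_sq]
    ring
  rw [h4, YangBaxterGrowth.inv_one_sub_X]
  ext n
  rw [YangBaxterGrowth.coeff_growthSeries]
  simp only [map_add, PowerSeries.coeff_C_mul, PowerSeries.coeff_X, PowerSeries.coeff_X_pow,
    PowerSeries.coeff_one, PowerSeries.coeff_X_pow_mul', PowerSeries.coeff_mk]
  match n with
  | 0 =>
    rw [pow_zero, ← Set.singleton_one, Set.ncard_singleton]
    simp
  | 1 =>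
    rw [YangBaxterGrowth.ncard_pow_one hd]
    simp
  | 2 =>
    rw [YangBaxterGrowth.ncard_pow_two hd, YangBaxterGrowth.sum_gcd_eq d hd]
    simp
  | m + 3 =>
    rw [YangBaxterGrowth.ncard_pow_add_three hd, YangBaxterGrowth.sum_divisors_eq hd]
    simp
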